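/- For $r\ge 1$ let $\mathcal{B}_r(\theta)=\sum_{k\in\mathbb{Z},\,k\neq 0}\frac{e^{ik\theta}}{(ik)^r}$ be the Bernoulli kernels, the sum being understood as the limit of the symmetric partial sums over $0<|k|\le N$ as $N\to\infty$, and let $$\mathcal{K}_1(\theta)=\mathcal{B}_1(\theta)\cos\theta,\qquad \mathcal{K}_2(\theta)=\mathcal{B}_1(\theta)\sin\theta .$$ For a $2\pi$-periodic integrable function $f$ let $$E_m(f)_{L^1}=\inf_{t\in T_m}\frac1{2\pi}\int_0^{2\pi}|f(\varphi)-t(\varphi)|\,d\varphi,$$ where $T_m=\{\sum_{|k|\le m}c_ke^{ik\varphi} : c_k\in\mathbb{C}\}$ is the space of trigonometric polynomials of degree at most $m$. Then $\mathcal{K}_1$ and $\mathcal{K}_2$ are integrable on $[0,2\pi]$ and, for every natural number $n\ge 2$, $$E_{n-1}(\mathcal{K}_1)_{L^1}=\tan\frac{\pi}{2n},\qquad E_{n-1}(\mathcal{K}_2)_{L^1}=\sec\frac{\pi}{2n}-1 .$$ -/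

import Mathlib

open Filter Topology

noncomputable section

/-- The Bernoulli kernel `∑_{k ≠ 0} e^{ikθ} / (ik)^r` for `r ≥ 1`, the sum being the limit of the
symmetric partial sums over `0 < |k| ≤ N` (for `r = 1` the convergence is only conditional). -/
def bernoulliKernel (r : ℕ) (θ : ℝ) : ℂ :=
  limUnder atTop fun N : ℕ =>
    ∑ k ∈ (Finset.Icc (-(N : ℤ)) (N : ℤ)).erase 0,
      Complex.exp (Complex.I * (k : ℂ) * (θ : ℂ)) / (Complex.I * (k : ℂ)) ^ r

/-- The kernel `B₁(θ) cos θ`. -/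
def quasiBernoulliCos (θ : ℝ) : ℂ := bernoulliKernel 1 θ * (Real.cos θ : ℂ)

/-- The kernel `B₁(θ) sin θ`. -/
def quasiBernoulliSin (θ : ℝ) : ℂ := bernoulliKernel 1 θ * (Real.sin θ : ℂ)

/-- Trigonometric polynomials with complex coefficients of degree at most `m`. -/
def trigPolynomials (m : ℕ) : Set (ℝ → ℂ) :=
  {t | ∃ c : ℤ → ℂ, ∀ φ : ℝ, t φ =
    ∑ k ∈ Finset.Icc (-(m : ℤ)) (m : ℤ), c k * Complex.exp (Complex.I * (k : ℂ) * (φ : ℂ))}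

/-- The normalized `L¹` norm `(1/2π) ∫₀^{2π} |f|` of a (`2π`-periodic) function. -/
def l1Norm (f : ℝ → ℂ) : ℝ :=
  1 / (2 * Real.pi) * ∫ φ in (0 : ℝ)..(2 * Real.pi), ‖f φ‖

/-- The best `L¹` approximation of `f` by trigonometric polynomials of degree at most `m`. -/
def bestL1Approx (m : ℕ) (f : ℝ → ℂ) : ℝ :=
  ⨅ t : trigPolynomials m, l1Norm (fun φ => f φ - (t : ℝ → ℂ) φ)

end

/-! On `(0, 2π)` the kernel `B₁` is the sawtooth `π - θ`, so the functions to approximate are `g =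
(π - θ) cos θ` and `g = (π - θ) sin θ`. The argument is by `L¹` duality. If `σ` changes sign under
translation by `π/n`, then `sign σ` is orthogonal to all trigonometric polynomials of degree less
than `n`, so the mean of `g * sign σ` bounds every error from below. The bound is attained once some
polynomial `t` of degree at most `n - 1` satisfies `g - t = σ G` with `G ≥ 0`
(`bestL1Approx_eq_integral_mul_sign`). Here `σ` is `sin nθ` for the cosine kernel and `-cos nθ` for
the sine kernel.

The polynomial `t` comes from `π - θ = sin θ ∫₀^∞ dx / (cosh x - cos θ)`. Christoffel–Darboux
identities show that replacing `sin kθ / sinh kx` by `sin (k+1)θ / sinh (k+1)x` over the denominator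
`cosh x - cos θ` costs only a trigonometric polynomial of degree `k`, and likewise for `cos` and
`cosh`. Induction on `n` then writes the error as `σ` times an integral of positive functions.

Finally, `exp (iθ) sign σ` is `2π`-periodic and is multiplied by `-exp (iπ/n)` under translation by
`π/n`; `intervalIntegral_moment_eq` therefore reduces its first moment to an elementary integral
over `(0, π/n)`. -/

/-! ### The first Bernoulli kernel as a sawtooth -/

/-- The Taylor series of `-log (1 - z)` converges on the unit circle away from `1`. -/
theorem tendsto_sum_pow_div_neg_log {w : ℂ} (hw : ‖w‖ = 1) (hw1 : w ≠ 1) :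
    Tendsto (fun N : ℕ => ∑ k ∈ Finset.range N, w ^ (k + 1) / ((k : ℂ) + 1)) atTop
      (𝓝 (-Complex.log (1 - w))) := by
  have hc : CauchySeq (fun N : ℕ =>
      ∑ k ∈ Finset.range N, (1 / ((k : ℝ) + 1)) • w ^ (k + 1)) := by
    -- Dirichlet's test: the geometric sums of `w` are bounded by `2 / ‖w - 1‖`.
    refine Antitone.cauchySeq_series_mul_of_tendsto_zero_of_bounded (b := 2 / ‖w - 1‖) ?_
      tendsto_one_div_add_atTop_nhds_zero_nat ?_
    · intro a b hab
      have : (a : ℝ) ≤ b := by exact_mod_cast hab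
      exact one_div_le_one_div_of_le (by positivity) (by linarith)
    · intro N
      have h : ∑ i ∈ Finset.range N, w ^ (i + 1) = w * ((w ^ N - 1) / (w - 1)) := by
        rw [← geom_sum_eq hw1, Finset.mul_sum]
        exact Finset.sum_congr rfl fun i _ => pow_succ' w i
      rw [h, norm_mul, hw, one_mul, norm_div]
      gcongr
      calc ‖w ^ N - 1‖ ≤ ‖w ^ N‖ + ‖(1 : ℂ)‖ := norm_sub_le _ _
        _ = 2 := by rw [norm_pow, hw]; norm_num
  obtain ⟨l, hl⟩ := cauchySeq_tendsto_of_complete hc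
  have hl' : Tendsto (fun N : ℕ => ∑ k ∈ Finset.range N, w ^ (k + 1) / ((k : ℂ) + 1)) atTop
      (𝓝 l) := by
    refine hl.congr fun N => Finset.sum_congr rfl fun k _ => ?_
    rw [Complex.real_smul]
    push_cast
    ring
  have hre : w.re < 1 := by
    refine lt_of_le_of_ne (hw ▸ Complex.re_le_norm w) fun h => hw1 ?_
    have h2 := Complex.sq_norm w
    rw [hw, Complex.normSq_apply, h] at h2
    exact Complex.ext h (by simpa using (by nlinarith : w.im = 0))
  -- Abel's limit theorem identifies the sum `l` with the radial limit of the logarithm.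
  have habel := (Complex.tendsto_tsum_powerSeries_nhdsWithin_lt hl')
  rw [tendsto_map'_iff] at habel
  have hlog : Tendsto (fun r : ℝ => -Complex.log (1 - r * w)) (𝓝[<] 1)
      (𝓝 (-Complex.log (1 - w))) := by
    have : ContinuousAt (fun r : ℝ => -Complex.log (1 - r * w)) 1 := by
      refine (ContinuousAt.clog (by fun_prop) ?_).neg
      left
      simpa using hre
    have h := this.tendsto
    simp only [Complex.ofReal_one, one_mul] at h
    exact h.mono_left nhdsWithin_le_nhds
  -- The power series pairs `w ^ (k + 1)` with `r ^ k`; an extra factor `r → 1` makes it a series in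
  -- `r * w`.
  have hmul : Tendsto (fun r : ℝ => (r : ℂ)) (𝓝[<] 1) (𝓝 1) := by
    have : ContinuousAt (fun r : ℝ => (r : ℂ)) 1 := by fun_prop
    simpa using this.tendsto.mono_left nhdsWithin_le_nhds
  have h3 := hmul.mul habel
  rw [one_mul] at h3
  have : l = -Complex.log (1 - w) := by
    refine tendsto_nhds_unique h3 (hlog.congr' ?_)
    have hev : ∀ᶠ r : ℝ in 𝓝[<] 1, 0 < r := nhdsWithin_le_nhds (eventually_gt_nhds one_pos)
    filter_upwards [self_mem_nhdsWithin, hev] with r hr hr0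
    have hn : ‖(r : ℂ) * w‖ < 1 := by
      rw [norm_mul, hw, mul_one, Complex.norm_real, Real.norm_of_nonneg hr0.le]
      exact hr
    have hs := (Complex.hasSum_taylorSeries_neg_log hn)
    -- The term of index `0` is `z ^ 0 / 0`, which is `0` by convention.
    rw [← hasSum_nat_add_iff' 1] at hs
    simp only [Finset.range_one, Finset.sum_singleton, pow_zero, Nat.cast_zero, div_zero,
      sub_zero] at hs
    rw [← hs.tsum_eq, Function.comp_apply, ← tsum_mul_left]
    refine tsum_congr fun k => ?_
    push_cast
    ring
  rwa [this] at hl'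

/-- The factorization `1 - exp (iθ) = 2 sin (θ/2) exp (i(θ - π)/2)` has positive modulus and an
angle in `(-π/2, π/2)`, so the angle is the principal argument. -/
theorem log_one_sub_exp_im {θ : ℝ} (hθ : θ ∈ Set.Ioo 0 (2 * Real.pi)) :
    (Complex.log (1 - Complex.exp (Complex.I * θ))).im = (θ - Real.pi) / 2 := by
  have hs : 0 < Real.sin (θ / 2) :=
    Real.sin_pos_of_pos_of_lt_pi (by linarith [hθ.1]) (by linarith [hθ.2])
  have h : 1 - Complex.exp (Complex.I * θ) = ((2 * Real.sin (θ / 2) : ℝ) : ℂ) *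
      (Complex.cos (((θ - Real.pi) / 2 : ℝ)) + Complex.sin (((θ - Real.pi) / 2 : ℝ)) *
        Complex.I) := by
    have h1 : (θ - Real.pi) / 2 = θ / 2 - Real.pi / 2 := by ring
    rw [← Complex.ofReal_cos, ← Complex.ofReal_sin, h1, Real.cos_sub_pi_div_two,
      Real.sin_sub_pi_div_two, mul_comm Complex.I, Complex.exp_mul_I, ← Complex.ofReal_cos,
      ← Complex.ofReal_sin]
    have hc : Real.cos θ = 1 - 2 * Real.sin (θ / 2) ^ 2 := by
      have := Real.cos_two_mul (θ / 2)
      rw [mul_div_cancel₀ θ two_ne_zero] at this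
      rw [this, Real.cos_sq']; ring
    have hsn : Real.sin θ = 2 * Real.sin (θ / 2) * Real.cos (θ / 2) := by
      have := Real.sin_two_mul (θ / 2)
      rwa [mul_div_cancel₀ θ two_ne_zero] at this
    rw [hc, hsn]
    push_cast
    ring
  rw [Complex.log_im, h, Complex.arg_mul_cos_add_sin_mul_I (by positivity)]
  exact ⟨by linarith [hθ.1, Real.pi_pos], by linarith [hθ.2, Real.pi_pos]⟩

theorem sum_Icc_neg_erase_zero (a : ℤ → ℂ) (N : ℕ) :
    ∑ k ∈ (Finset.Icc (-(N : ℤ)) (N : ℤ)).erase 0, a k =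
      ∑ k ∈ Finset.range N, (a (k + 1) + a (-(k + 1))) := by
  induction N with
  | zero => simp
  | succ N ih =>
    have h : (Finset.Icc (-((N + 1 : ℕ) : ℤ)) ((N + 1 : ℕ) : ℤ)).erase 0 =
        insert ((N : ℤ) + 1) (insert (-((N : ℤ) + 1))
          ((Finset.Icc (-(N : ℤ)) (N : ℤ)).erase 0)) := by
      ext k
      simp only [Finset.mem_erase, Finset.mem_Icc, Finset.mem_insert]
      omega
    rw [h, Finset.sum_insert, Finset.sum_insert, ih, Finset.sum_range_succ]
    · ring
    · simp only [Finset.mem_erase, Finset.mem_Icc]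
      omega
    · simp only [Finset.mem_erase, Finset.mem_Icc, Finset.mem_insert]
      omega

/-- On `(0, 2π)` the first Bernoulli kernel is the sawtooth `π - θ`. -/
theorem bernoulliKernel_one_eq {θ : ℝ} (hθ : θ ∈ Set.Ioo 0 (2 * Real.pi)) :
    bernoulliKernel 1 θ = ((Real.pi - θ : ℝ) : ℂ) := by
  set w := Complex.exp (Complex.I * θ) with hw
  have hnorm : ‖w‖ = 1 := by rw [hw, mul_comm]; exact Complex.norm_exp_ofReal_mul_I θ
  have hw1 : w ≠ 1 := by
    intro h
    have hs : 0 < Real.sin (θ / 2) :=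
      Real.sin_pos_of_pos_of_lt_pi (by linarith [hθ.1]) (by linarith [hθ.2])
    have h2 : Real.cos θ = 1 := by
      have := congrArg Complex.re h
      rwa [hw, mul_comm, Complex.exp_ofReal_mul_I_re, Complex.one_re] at this
    have := Real.cos_two_mul (θ / 2)
    rw [mul_div_cancel₀ θ two_ne_zero, h2, Real.cos_sq'] at this
    nlinarith
  have hlim := (Complex.continuous_im.tendsto _).comp (tendsto_sum_pow_div_neg_log hnorm hw1)
  have hlim2 := (Complex.continuous_ofReal.tendsto _).comp (hlim.const_mul 2)
  rw [Complex.neg_im, log_one_sub_exp_im hθ] at hlim2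
  refine Tendsto.limUnder_eq ?_
  -- The terms `k` and `-k` add up to `2 sin (kθ) / k`, twice the imaginary part of a term of the
  -- logarithm series.
  convert hlim2 using 1
  · funext N
    rw [sum_Icc_neg_erase_zero]
    simp only [Function.comp_apply, Complex.im_sum, Finset.mul_sum, Complex.ofReal_sum]
    refine Finset.sum_congr rfl fun k _ => ?_
    have hk : ((k : ℂ) + 1) ≠ 0 := by exact_mod_cast k.succ_ne_zero
    have h1 : w ^ (k + 1) = Complex.exp ((((k : ℝ) + 1) * θ : ℝ) * Complex.I) := by
      rw [hw, ← Complex.exp_nat_mul]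
      congr 1
      push_cast
      ring
    have h2 : (w ^ (k + 1) / ((k : ℂ) + 1)).im = Real.sin (((k : ℝ) + 1) * θ) / (k + 1) := by
      rw [h1, show ((k : ℂ) + 1) = (((k : ℝ) + 1 : ℝ) : ℂ) by push_cast; rfl, Complex.div_ofReal_im,
        Complex.exp_ofReal_mul_I_im]
    rw [h2]
    push_cast
    rw [Complex.sin, pow_one, pow_one]
    have e1 : Complex.I * ((k : ℂ) + 1) * θ = (k + 1) * θ * Complex.I := by ring
    have e2 : Complex.I * -((k : ℂ) + 1) * θ = -((k + 1) * θ) * Complex.I := by ring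
    rw [e1, e2]
    field_simp
    rw [Complex.I_sq]
    ring
  · congr 2
    ring

/-! ### Integrability against a sign -/

theorem norm_real_sign_le (x : ℝ) : ‖Real.sign x‖ ≤ 1 := by
  rcases Real.sign_apply_eq x with h | h | h <;> rw [h] <;> norm_num

theorem measurable_real_sign : Measurable Real.sign :=
  Measurable.ite measurableSet_Iio measurable_const
    (Measurable.ite measurableSet_Ioi measurable_const measurable_const)

theorem intervalIntegrable_mul_sign {u : ℝ → ℂ} {a b : ℝ}
    (hu : IntervalIntegrable u MeasureTheory.volume a b) {σ : ℝ → ℝ} (hσ : Continuous σ) :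
    IntervalIntegrable (fun θ => u θ * (Real.sign (σ θ) : ℂ)) MeasureTheory.volume a b := by
  have hb : ∀ μ : MeasureTheory.Measure ℝ, MeasureTheory.AEStronglyMeasurable
      (fun θ => (Real.sign (σ θ) : ℂ)) μ := fun μ =>
    (Complex.measurable_ofReal.comp
      (measurable_real_sign.comp hσ.measurable)).aestronglyMeasurable
  have hn : ∀ θ, ‖(Real.sign (σ θ) : ℂ)‖ ≤ 1 := fun θ => by
    rw [Complex.norm_real]
    exact norm_real_sign_le _
  exact ⟨hu.1.mul_bdd (c := 1) (hb _) (Eventually.of_forall hn),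
    hu.2.mul_bdd (c := 1) (hb _) (Eventually.of_forall hn)⟩

theorem exp_mul_I_ne_neg_one {x : ℝ} (hx : |x| < Real.pi) :
    Complex.exp (x * Complex.I) ≠ -1 := by
  intro h
  have h1 := congrArg Complex.re h
  rw [Complex.exp_ofReal_mul_I_re, ← Real.cos_abs] at h1
  have h2 := Real.cos_lt_cos_of_nonneg_of_le_pi (abs_nonneg x) le_rfl hx
  rw [h1, Real.cos_pi] at h2
  simp at h2

/-! ### Integrals of quasi-periodic functions -/

section Quasiperiodic

variable {h : ℝ → ℂ} {w : ℂ} {T δ : ℝ}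

theorem intervalIntegral_shift_eq (hδ : ∀ θ, h (θ + δ) = w * h θ) (a b : ℝ) :
    ∫ θ in (a + δ)..(b + δ), h θ = w * ∫ θ in a..b, h θ := by
  rw [← intervalIntegral.integral_comp_add_right, ← intervalIntegral.integral_const_mul]
  simp only [hδ]

/-- Translation by `δ` multiplies the integral over a period by `w` and also leaves it unchanged. -/
theorem intervalIntegral_period_eq_zero (hT : Function.Periodic h T)
    (hδ : ∀ θ, h (θ + δ) = w * h θ) (hw : w ≠ 1) : ∫ θ in (0 : ℝ)..T, h θ = 0 := by
  have h1 := intervalIntegral_shift_eq hδ 0 T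
  have h2 := hT.intervalIntegral_add_eq δ 0
  rw [zero_add, add_comm T δ, h2, zero_add] at h1
  have h3 : (w - 1) * ∫ θ in (0 : ℝ)..T, h θ = 0 := by rw [sub_mul, ← h1]; ring
  exact (mul_eq_zero.mp h3).resolve_left (sub_ne_zero.mpr hw)

/-- The first moment over a period of a periodic function which is also quasi-periodic with
multiplier `w ≠ 1`. -/
theorem intervalIntegral_moment_eq (hint : ∀ a b, IntervalIntegrable h MeasureTheory.volume a b)
    (hT : Function.Periodic h T) (hδ : ∀ θ, h (θ + δ) = w * h θ) (hw : w ≠ 1) (c : ℝ) :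
    ∫ θ in (0 : ℝ)..T, ((c - θ : ℝ) : ℂ) * h θ = T / (1 - w) * ∫ θ in (0 : ℝ)..δ, h θ := by
  have hz := intervalIntegral_period_eq_zero hT hδ hw
  have hI : ∀ a b, IntervalIntegrable (fun θ : ℝ => (θ : ℂ) * h θ) MeasureTheory.volume a b :=
    fun a b => (hint a b).continuousOn_mul (by fun_prop)
  set M := ∫ θ in (0 : ℝ)..T, (θ : ℂ) * h θ with hM
  have h1 : ∫ θ in (0 : ℝ)..T, ((c - θ : ℝ) : ℂ) * h θ = -M := by
    have : (fun θ : ℝ => ((c - θ : ℝ) : ℂ) * h θ) = fun θ : ℝ => (c : ℂ) * h θ - θ * h θ := by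
      funext θ; push_cast; ring
    rw [this, intervalIntegral.integral_sub ((hint _ _).const_mul _) (hI _ _),
      intervalIntegral.integral_const_mul, hz]
    ring
  have h2 : ∫ θ in δ..(T + δ), (θ : ℂ) * h θ = w * M := by
    have := intervalIntegral.integral_comp_add_right (a := 0) (b := T)
      (fun θ : ℝ => (θ : ℂ) * h θ) δ
    rw [zero_add] at this
    rw [← this]
    have h3 : (fun θ : ℝ => ((θ + δ : ℝ) : ℂ) * h (θ + δ)) =
        fun θ : ℝ => w * ((θ : ℂ) * h θ) + w * δ * h θ := by
      funext θ; rw [hδ]; push_cast; ring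
    rw [h3, intervalIntegral.integral_add ((hI _ _).const_mul _) ((hint _ _).const_mul _),
      intervalIntegral.integral_const_mul, intervalIntegral.integral_const_mul, hz, hM]
    ring
  have h4 : ∫ θ in T..(T + δ), (θ : ℂ) * h θ =
      (∫ θ in (0 : ℝ)..δ, (θ : ℂ) * h θ) + T * ∫ θ in (0 : ℝ)..δ, h θ := by
    have := intervalIntegral.integral_comp_add_right (a := 0) (b := δ)
      (fun θ : ℝ => (θ : ℂ) * h θ) T
    rw [zero_add, add_comm δ T] at this
    rw [← this]
    have h3 : (fun θ : ℝ => ((θ + T : ℝ) : ℂ) * h (θ + T)) =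
        fun θ : ℝ => (θ : ℂ) * h θ + T * h θ := by
      funext θ; rw [hT]; push_cast; ring
    rw [h3, intervalIntegral.integral_add (hI _ _) ((hint _ _).const_mul _),
      intervalIntegral.integral_const_mul]
  -- Cutting `[0, T + δ]` at `δ` and at `T` gives two expressions for one moment, hence a linear
  -- equation for `M`.
  have h5 := intervalIntegral.integral_add_adjacent_intervals (hI 0 δ) (hI δ (T + δ))
  have h6 := intervalIntegral.integral_add_adjacent_intervals (hI 0 T) (hI T (T + δ))
  rw [h2] at h5
  rw [h4, ← h5] at h6
  have hw' : 1 - w ≠ 0 := sub_ne_zero.mpr hw.symm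
  rw [h1]
  field_simp
  linear_combination -h6

end Quasiperiodic

/-! ### Orthogonality of antiperiodic signs and `L¹` duality -/

section Antiperiodic

variable {n : ℕ} {σ : ℝ → ℝ}

theorem periodic_two_pi_of_antiperiodic (hn : n ≠ 0)
    (hanti : Function.Antiperiodic σ (Real.pi / n)) : Function.Periodic σ (2 * Real.pi) := by
  have h := hanti.even_nsmul_periodic n
  have hn' : (n : ℝ) ≠ 0 := by exact_mod_cast hn
  have : (2 * n) • (Real.pi / n) = 2 * Real.pi := by
    rw [nsmul_eq_mul]
    push_cast
    field_simp
  rwa [this] at h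

theorem periodic_exp_mul_sign (hn : n ≠ 0) (hanti : Function.Antiperiodic σ (Real.pi / n))
    (k : ℤ) : Function.Periodic
      (fun θ : ℝ => Complex.exp (Complex.I * k * θ) * (Real.sign (σ θ) : ℂ)) (2 * Real.pi) := by
  intro θ
  simp only
  rw [periodic_two_pi_of_antiperiodic hn hanti θ]
  congr 1
  refine Complex.exp_eq_exp_iff_exists_int.mpr ⟨k, ?_⟩
  push_cast
  ring

theorem exp_mul_sign_add (hanti : Function.Antiperiodic σ (Real.pi / n)) (k : ℤ) (θ : ℝ) :
    Complex.exp (Complex.I * k * ((θ + Real.pi / n : ℝ) : ℂ)) *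
        (Real.sign (σ (θ + Real.pi / n)) : ℂ) =
      -Complex.exp ((k * (Real.pi / n) : ℝ) * Complex.I) *
        (Complex.exp (Complex.I * k * θ) * (Real.sign (σ θ) : ℂ)) := by
  rw [hanti θ, Real.sign_neg]
  have : Complex.I * k * ((θ + Real.pi / n : ℝ) : ℂ) =
      (k * (Real.pi / n) : ℝ) * Complex.I + Complex.I * k * θ := by push_cast; ring
  rw [this, Complex.exp_add]
  push_cast
  ring

/-- This is where the degree bound enters: for `|k| < n` the angle `kπ/n` stays strictly between
`-π` and `π`. -/
theorem neg_exp_ne_one {k : ℤ} (hk : |k| < n) :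
    -Complex.exp ((k * (Real.pi / n) : ℝ) * Complex.I) ≠ 1 := by
  have hn : (0 : ℝ) < n := by exact_mod_cast (abs_nonneg k).trans_lt hk
  intro h
  refine exp_mul_I_ne_neg_one ?_ (neg_eq_iff_eq_neg.mp h)
  rw [abs_mul, abs_of_pos (div_pos Real.pi_pos hn), ← mul_div_assoc, div_lt_iff₀ hn, mul_comm]
  have : |(k : ℝ)| < n := by exact_mod_cast hk
  exact mul_lt_mul_of_pos_left this Real.pi_pos

theorem continuous_of_mem_trigPolynomials {m : ℕ} {t : ℝ → ℂ} (ht : t ∈ trigPolynomials m) :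
    Continuous t := by
  obtain ⟨c, hc⟩ := ht
  rw [funext hc]
  fun_prop

/-- The sign of a continuous `π/n`-antiperiodic function is orthogonal to the trigonometric
polynomials of degree less than `n`. -/
theorem integral_trigPolynomial_mul_sign (hn : n ≠ 0) (hσ : Continuous σ)
    (hanti : Function.Antiperiodic σ (Real.pi / n)) {t : ℝ → ℂ}
    (ht : t ∈ trigPolynomials (n - 1)) :
    ∫ θ in (0 : ℝ)..(2 * Real.pi), t θ * (Real.sign (σ θ) : ℂ) = 0 := by
  obtain ⟨c, hc⟩ := ht
  simp only [hc, Finset.sum_mul, mul_assoc]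
  rw [intervalIntegral.integral_finsetSum]
  · refine Finset.sum_eq_zero fun k hk => ?_
    rw [intervalIntegral.integral_const_mul]
    have hk' : |k| < n := by
      rw [Finset.mem_Icc] at hk
      rw [abs_lt]
      omega
    have := intervalIntegral_period_eq_zero (periodic_exp_mul_sign hn hanti k)
      (exp_mul_sign_add hanti k) (neg_exp_ne_one hk')
    simp only [mul_assoc] at this
    rw [this, mul_zero]
  · intro k _
    refine (intervalIntegrable_mul_sign ?_ hσ).const_mul _
    exact Continuous.intervalIntegrable (by fun_prop) _ _

theorem ae_mem_Ioo_of_mem_uIoc (a b : ℝ) (hab : a ≤ b) :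
    ∀ᵐ θ : ℝ, θ ∈ Set.uIoc a b → θ ∈ Set.Ioo a b := by
  filter_upwards [MeasureTheory.Measure.ae_ne MeasureTheory.volume b] with θ hθ h
  rw [Set.uIoc_of_le hab] at h
  exact ⟨h.1, lt_of_le_of_ne h.2 hθ⟩

/-- The values of `K` at the endpoints, where the sawtooth formula is not available, form a null
set. -/
theorem intervalIntegrable_of_eqOn_Ioo {K u : ℝ → ℂ} (hu : Continuous u) {a b : ℝ} (hab : a ≤ b)
    (hK : ∀ θ ∈ Set.Ioo a b, K θ = u θ) :
    IntervalIntegrable K MeasureTheory.volume a b := by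
  refine (hu.intervalIntegrable a b).congr_ae ?_
  rw [Filter.EventuallyEq, MeasureTheory.ae_restrict_iff' measurableSet_uIoc]
  filter_upwards [ae_mem_Ioo_of_mem_uIoc a b hab] with θ hθ h
  exact (hK θ (hθ h)).symm

theorem l1Norm_nonneg (f : ℝ → ℂ) : 0 ≤ l1Norm f :=
  mul_nonneg (by have := Real.pi_pos; positivity)
    (intervalIntegral.integral_nonneg (by have := Real.pi_pos; positivity)
      fun _ _ => norm_nonneg _)

/-- Duality: if the error of some approximation to `g` has the sign of an antiperiodic function `σ`,
then this approximation is a best one, and the error is the integral of `g` against `sign σ`. -/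
theorem bestL1Approx_eq_integral_mul_sign (hn : n ≠ 0) {K : ℝ → ℂ} {g : ℝ → ℝ}
    (hg : Continuous g) (hK : ∀ θ ∈ Set.Ioo 0 (2 * Real.pi), K θ = g θ) (hσ : Continuous σ)
    (hanti : Function.Antiperiodic σ (Real.pi / n)) {t G : ℝ → ℝ}
    (ht : (fun θ => (t θ : ℂ)) ∈ trigPolynomials (n - 1))
    (hG : ∀ θ ∈ Set.Ioo 0 (2 * Real.pi), θ ≠ Real.pi → 0 ≤ G θ ∧ g θ - t θ = σ θ * G θ) :
    bestL1Approx (n - 1) K =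
      1 / (2 * Real.pi) * ∫ θ in (0 : ℝ)..(2 * Real.pi), g θ * Real.sign (σ θ) := by
  have hpi := Real.pi_pos
  have hpi2 : (0 : ℝ) ≤ 2 * Real.pi := by positivity
  have hae := ae_mem_Ioo_of_mem_uIoc 0 (2 * Real.pi) hpi2
  have hgc : Continuous fun θ => (g θ : ℂ) := by fun_prop
  have hpair : ∀ u ∈ trigPolynomials (n - 1),
      ∫ θ in (0 : ℝ)..(2 * Real.pi), ((g θ : ℂ) - u θ) * (Real.sign (σ θ) : ℂ) =
        ((∫ θ in (0 : ℝ)..(2 * Real.pi), g θ * Real.sign (σ θ) : ℝ) : ℂ) := by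
    intro u hu
    simp only [sub_mul]
    rw [intervalIntegral.integral_sub, integral_trigPolynomial_mul_sign hn hσ hanti hu, sub_zero,
      ← intervalIntegral.integral_ofReal]
    · simp only [Complex.ofReal_mul]
    · exact intervalIntegrable_mul_sign (hgc.intervalIntegrable _ _) hσ
    · exact intervalIntegrable_mul_sign
        ((continuous_of_mem_trigPolynomials hu).intervalIntegrable _ _) hσ
  have hl1 : ∀ u : ℝ → ℂ, l1Norm (fun θ => K θ - u θ) =
      1 / (2 * Real.pi) * ∫ θ in (0 : ℝ)..(2 * Real.pi), ‖(g θ : ℂ) - u θ‖ := by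
    intro u
    unfold l1Norm
    congr 1
    refine intervalIntegral.integral_congr_ae ?_
    filter_upwards [hae] with θ hθ h
    rw [hK θ (hθ h)]
  refine le_antisymm ?_ ?_
  · have hb : BddBelow (Set.range fun u : trigPolynomials (n - 1) =>
        l1Norm (fun φ => K φ - (u : ℝ → ℂ) φ)) :=
      ⟨0, by rintro _ ⟨u, rfl⟩; exact l1Norm_nonneg _⟩
    refine (ciInf_le hb ⟨_, ht⟩).trans_eq ?_
    rw [hl1]
    congr 1
    -- Almost everywhere `|g - t| = (g - t) sign σ`, because `g - t = σ G` with `G ≥ 0`.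
    rw [← Complex.ofReal_inj, ← hpair _ ht, ← intervalIntegral.integral_ofReal]
    refine intervalIntegral.integral_congr_ae ?_
    filter_upwards [hae, MeasureTheory.Measure.ae_ne MeasureTheory.volume Real.pi] with θ hθ hne h
    obtain ⟨h0, h1⟩ := hG θ (hθ h) hne
    rw [← Complex.ofReal_sub, Complex.norm_real, ← Complex.ofReal_mul, h1, norm_mul,
      Real.norm_of_nonneg h0, Real.norm_eq_abs]
    rcases lt_trichotomy (σ θ) 0 with hs | hs | hs
    · rw [Real.sign_of_neg hs, abs_of_neg hs]; congr 1; ring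
    · rw [hs]; simp
    · rw [Real.sign_of_pos hs, abs_of_pos hs]; congr 1; ring
  · have : Nonempty (trigPolynomials (n - 1)) := ⟨⟨_, ht⟩⟩
    refine le_ciInf fun u => ?_
    rw [hl1]
    gcongr
    -- Lower bound for an arbitrary `u`: the pairing does not see `u`, and `|sign σ| ≤ 1`.
    refine (Real.le_norm_self _).trans ?_
    rw [← Complex.norm_real, ← hpair u u.2]
    refine intervalIntegral.norm_integral_le_of_norm_le hpi2 (Eventually.of_forall fun θ _ => ?_) ?_
    · rw [norm_mul, Complex.norm_real]
      exact mul_le_of_le_one_right (norm_nonneg _) (norm_real_sign_le _)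
    · have := continuous_of_mem_trigPolynomials u.2
      exact Continuous.intervalIntegrable (by fun_prop) _ _

end Antiperiodic

/-! ### The sawtooth as an integral of `1 / (cosh x - cos θ)` -/

open MeasureTheory

theorem cosh_sub_cos_pos {x : ℝ} (hx : 0 < x) (θ : ℝ) : 0 < Real.cosh x - Real.cos θ := by
  linarith [Real.one_lt_cosh.mpr hx.ne', Real.cos_le_one θ]

/-- An antiderivative is `(2 / sin θ) arctan ((exp x - cos θ) / sin θ)`. The arctangent tends to
`π/2` at infinity, and at `x = 0` it equals `θ/2` by the half-angle formula for the tangent. -/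
theorem integral_one_div_cosh_sub_cos_of_lt_pi {θ : ℝ} (h0 : 0 < θ) (hpi : θ < Real.pi) :
    IntegrableOn (fun x => 1 / (Real.cosh x - Real.cos θ)) (Set.Ioi 0) ∧
      Real.sin θ * ∫ x in Set.Ioi 0, 1 / (Real.cosh x - Real.cos θ) = Real.pi - θ := by
  have hs : 0 < Real.sin θ := Real.sin_pos_of_pos_of_lt_pi h0 hpi
  set F : ℝ → ℝ := fun x => 2 / Real.sin θ * Real.arctan ((Real.exp x - Real.cos θ) / Real.sin θ)
    with hF
  have hcont : ContinuousWithinAt F (Set.Ici 0) 0 := by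
    apply Continuous.continuousWithinAt
    have := Real.continuous_arctan
    fun_prop
  have hderiv : ∀ x ∈ Set.Ioi (0 : ℝ), HasDerivAt F (1 / (Real.cosh x - Real.cos θ)) x := by
    intro x hx
    have h1 := ((((Real.hasDerivAt_exp x).sub_const (Real.cos θ)).div_const
      (Real.sin θ)).arctan).const_mul (2 / Real.sin θ)
    refine h1.congr_deriv (Eq.symm ?_)
    have hD := cosh_sub_cos_pos hx θ
    rw [Real.cosh_eq] at hD ⊢
    rw [Real.exp_neg] at hD ⊢
    have he := Real.exp_pos x
    have hsq := Real.sin_sq_add_cos_sq θ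
    have h2 : 1 + ((Real.exp x - Real.cos θ) / Real.sin θ) ^ 2 =
        2 * Real.exp x * ((Real.exp x + (Real.exp x)⁻¹) / 2 - Real.cos θ) / Real.sin θ ^ 2 := by
      field_simp
      linear_combination hsq
    rw [h2]
    field_simp
  have hnonneg : ∀ x ∈ Set.Ioi (0 : ℝ), 0 ≤ 1 / (Real.cosh x - Real.cos θ) := fun x hx =>
    (one_div_pos.mpr (cosh_sub_cos_pos hx θ)).le
  have hlim : Tendsto F atTop (𝓝 (2 / Real.sin θ * (Real.pi / 2))) := by
    refine Tendsto.const_mul _ ?_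
    refine (tendsto_nhds_of_tendsto_nhdsWithin Real.tendsto_arctan_atTop).comp ?_
    refine Tendsto.atTop_div_const hs ?_
    exact tendsto_atTop_add_const_right _ _ Real.tendsto_exp_atTop
  refine ⟨integrableOn_Ioi_deriv_of_nonneg hcont hderiv hnonneg hlim, ?_⟩
  rw [integral_Ioi_of_hasDerivAt_of_nonneg hcont hderiv hnonneg hlim]
  have hF0 : F 0 = 2 / Real.sin θ * (θ / 2) := by
    have hc : 0 < Real.cos (θ / 2) :=
      Real.cos_pos_of_mem_Ioo ⟨by linarith, by linarith⟩
    have hs2 : 0 < Real.sin (θ / 2) := Real.sin_pos_of_pos_of_lt_pi (by linarith) (by linarith)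
    have : (Real.exp 0 - Real.cos θ) / Real.sin θ = Real.tan (θ / 2) := by
      have h1 := Real.cos_two_mul (θ / 2)
      have h2 := Real.sin_two_mul (θ / 2)
      rw [mul_div_cancel₀ θ two_ne_zero] at h1 h2
      rw [Real.exp_zero, h1, h2, Real.tan_eq_sin_div_cos, Real.cos_sq']
      field_simp
      ring
    simp only [hF]
    rw [this, Real.arctan_tan (by linarith) (by linarith)]
  rw [hF0]
  field_simp

/-- The reflection `θ ↦ 2π - θ` preserves `cos` and negates both `sin θ` and `π - θ`. The point `π`,
where the antiderivative divides by `sin π = 0`, is negligible for the `L¹` norm. -/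
theorem integral_one_div_cosh_sub_cos {θ : ℝ} (hθ : θ ∈ Set.Ioo 0 (2 * Real.pi))
    (hne : θ ≠ Real.pi) :
    IntegrableOn (fun x => 1 / (Real.cosh x - Real.cos θ)) (Set.Ioi 0) ∧
      Real.sin θ * ∫ x in Set.Ioi 0, 1 / (Real.cosh x - Real.cos θ) = Real.pi - θ := by
  rcases lt_or_gt_of_ne hne with h | h
  · exact integral_one_div_cosh_sub_cos_of_lt_pi hθ.1 h
  · obtain ⟨h1, h2⟩ := integral_one_div_cosh_sub_cos_of_lt_pi (θ := 2 * Real.pi - θ)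
      (by linarith [hθ.2]) (by linarith)
    rw [Real.cos_two_pi_sub] at h1 h2
    rw [Real.sin_two_pi_sub] at h2
    exact ⟨h1, by linarith⟩

theorem integrableOn_one_div_cosh : IntegrableOn (fun x => 1 / Real.cosh x) (Set.Ioi 0) := by
  have h := (integral_one_div_cosh_sub_cos_of_lt_pi (θ := Real.pi / 2)
    (by linarith [Real.pi_pos]) (by linarith [Real.pi_pos])).1
  simpa [Real.cos_pi_div_two] using h

theorem integrableOn_Ioi_of_nonneg_of_le {f g : ℝ → ℝ} (hg : IntegrableOn g (Set.Ioi 0))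
    (hf : Measurable f) (h0 : ∀ x, 0 < x → 0 ≤ f x) (h : ∀ x, 0 < x → f x ≤ g x) :
    IntegrableOn f (Set.Ioi 0) := by
  refine Integrable.mono' hg hf.aestronglyMeasurable ?_
  filter_upwards [ae_restrict_mem measurableSet_Ioi] with x hx
  rw [Real.norm_of_nonneg (h0 x hx)]
  exact h x hx

/-! ### Closure properties of trigonometric polynomials -/

section TrigPolynomials

theorem zero_mem_trigPolynomials (m : ℕ) : (fun _ => 0) ∈ trigPolynomials m :=
  ⟨fun _ => 0, fun φ => by simp⟩

theorem add_mem_trigPolynomials {m : ℕ} {s t : ℝ → ℂ} (hs : s ∈ trigPolynomials m)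
    (ht : t ∈ trigPolynomials m) : (fun θ => s θ + t θ) ∈ trigPolynomials m := by
  obtain ⟨c, hc⟩ := hs
  obtain ⟨d, hd⟩ := ht
  refine ⟨fun k => c k + d k, fun φ => ?_⟩
  simp only
  rw [hc, hd, ← Finset.sum_add_distrib]
  exact Finset.sum_congr rfl fun k _ => by ring

theorem sum_mem_trigPolynomials {ι : Type*} {m : ℕ} (s : Finset ι) {t : ι → ℝ → ℂ}
    (ht : ∀ i ∈ s, t i ∈ trigPolynomials m) :
    (fun θ => ∑ i ∈ s, t i θ) ∈ trigPolynomials m := by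
  classical
  induction s using Finset.induction_on with
  | empty => simpa using zero_mem_trigPolynomials m
  | insert a s ha ih =>
    simp only [Finset.sum_insert ha]
    exact add_mem_trigPolynomials (ht a (Finset.mem_insert_self a s))
      (ih fun i hi => ht i (Finset.mem_insert_of_mem hi))

theorem exp_mem_trigPolynomials {m : ℕ} (a : ℂ) {k : ℤ}
    (hk : k ∈ Finset.Icc (-(m : ℤ)) (m : ℤ)) :
    (fun θ : ℝ => a * Complex.exp (Complex.I * k * θ)) ∈ trigPolynomials m := by
  refine ⟨fun j => if j = k then a else 0, fun φ => ?_⟩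
  simp only [ite_mul, zero_mul, Finset.sum_ite_eq', hk, if_true]

theorem trigPolynomials_mono {m m' : ℕ} (h : m ≤ m') : trigPolynomials m ⊆ trigPolynomials m' := by
  rintro t ⟨c, hc⟩
  rw [funext hc]
  refine sum_mem_trigPolynomials _ fun k hk => exp_mem_trigPolynomials _ ?_
  rw [Finset.mem_Icc] at hk ⊢
  omega

theorem cos_mem_trigPolynomials {m j : ℕ} (hj : j ≤ m) (a : ℝ) :
    (fun θ : ℝ => ((a * Real.cos (j * θ) : ℝ) : ℂ)) ∈ trigPolynomials m := by
  have h := add_mem_trigPolynomials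
    (exp_mem_trigPolynomials (m := m) ((a : ℂ) / 2) (k := j) (by rw [Finset.mem_Icc]; omega))
    (exp_mem_trigPolynomials (m := m) ((a : ℂ) / 2) (k := -j) (by rw [Finset.mem_Icc]; omega))
  convert h using 2 with θ
  push_cast
  rw [Complex.cos]
  ring_nf

theorem sin_mem_trigPolynomials {m j : ℕ} (hj : j ≤ m) (a : ℝ) :
    (fun θ : ℝ => ((a * Real.sin (j * θ) : ℝ) : ℂ)) ∈ trigPolynomials m := by
  have h := add_mem_trigPolynomials
    (exp_mem_trigPolynomials (m := m) (-(a : ℂ) * Complex.I / 2) (k := j)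
      (by rw [Finset.mem_Icc]; omega))
    (exp_mem_trigPolynomials (m := m) ((a : ℂ) * Complex.I / 2) (k := -j)
      (by rw [Finset.mem_Icc]; omega))
  convert h using 2 with θ
  push_cast
  rw [Complex.sin]
  ring_nf

end TrigPolynomials

/-! ### Christoffel–Darboux identities -/

section ChristoffelDarboux

/-- Both `sinh kx` and `sin kθ` solve `y (k+1) + y (k-1) = 2 c y k`, with `c = cosh x` and `c = cos
θ`; the difference of the two recurrences telescopes. -/
theorem sinh_mul_sin_sub_eq (x θ : ℝ) (k : ℕ) :
    Real.sinh ((k + 1) * x) * Real.sin (k * θ) - Real.sinh (k * x) * Real.sin ((k + 1) * θ) =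
      (Real.cosh x - Real.cos θ) *
        ∑ j ∈ Finset.range k, 2 * Real.sinh ((j + 1) * x) * Real.sin ((j + 1) * θ) := by
  induction k with
  | zero => simp
  | succ k ih =>
    rw [Finset.sum_range_succ, mul_add, ← ih]
    push_cast
    have e1 : ((k : ℝ) + 1 + 1) * x = (k + 1) * x + x := by ring
    have e2 : ((k : ℝ) + 1 + 1) * θ = (k + 1) * θ + θ := by ring
    have e3 : (k : ℝ) * x = (k + 1) * x - x := by ring
    have e4 : (k : ℝ) * θ = (k + 1) * θ - θ := by ring
    rw [e1, e2, e3, e4, Real.sinh_add, Real.sinh_sub, Real.sin_add, Real.sin_sub]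
    ring

theorem cosh_mul_cos_sub_eq (x θ : ℝ) (k : ℕ) :
    Real.cosh ((k + 1) * x) * Real.cos (k * θ) - Real.cosh (k * x) * Real.cos ((k + 1) * θ) =
      (Real.cosh x - Real.cos θ) *
        (1 + ∑ j ∈ Finset.range k, 2 * Real.cosh ((j + 1) * x) * Real.cos ((j + 1) * θ)) := by
  induction k with
  | zero => simp
  | succ k ih =>
    rw [Finset.sum_range_succ, ← add_assoc, mul_add, ← ih]
    push_cast
    have e1 : ((k : ℝ) + 1 + 1) * x = (k + 1) * x + x := by ring
    have e2 : ((k : ℝ) + 1 + 1) * θ = (k + 1) * θ + θ := by ring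
    have e3 : (k : ℝ) * x = (k + 1) * x - x := by ring
    have e4 : (k : ℝ) * θ = (k + 1) * θ - θ := by ring
    rw [e1, e2, e3, e4, Real.cosh_add, Real.cosh_sub, Real.cos_add, Real.cos_sub]
    ring

end ChristoffelDarboux

/-! ### Hyperbolic inequalities dominating the integrands -/

section HyperbolicBounds

variable {x : ℝ}

theorem sinh_nat_mul_le {j k : ℕ} (hjk : j ≤ k) (hx : 0 < x) :
    Real.sinh (j * x) ≤ Real.sinh (k * x) := by
  rw [Real.sinh_le_sinh]
  gcongr

theorem cosh_nat_mul_le {j k : ℕ} (hjk : j ≤ k) (hx : 0 < x) :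
    Real.cosh (j * x) ≤ Real.cosh (k * x) := by
  rw [Real.cosh_le_cosh, abs_of_nonneg (by positivity), abs_of_nonneg (by positivity)]
  gcongr

theorem sinh_nat_mul_pos {k : ℕ} (hk : 0 < k) (hx : 0 < x) : 0 < Real.sinh (k * x) := by
  rw [Real.sinh_pos_iff]
  positivity

theorem sinh_mul_cosh_le_sinh {k : ℕ} (hk : 2 ≤ k) (hx : 0 < x) :
    Real.sinh x * Real.cosh x ≤ Real.sinh (k * x) := by
  have h := sinh_nat_mul_le hk hx
  rw [Nat.cast_ofNat, Real.sinh_two_mul] at h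
  have := mul_pos (Real.sinh_pos_iff.mpr hx) (Real.cosh_pos x)
  linarith

theorem two_mul_sinh_mul_cosh_sq_le_sinh {k : ℕ} (hk : 3 ≤ k) (hx : 0 < x) :
    2 * Real.sinh x * Real.cosh x ^ 2 ≤ Real.sinh (k * x) := by
  have h := sinh_nat_mul_le hk hx
  rw [Nat.cast_ofNat, Real.sinh_three_mul] at h
  rw [Real.cosh_sq]
  have h1 := Real.sinh_pos_iff.mpr hx
  have h2 : 0 < Real.sinh x ^ 3 := by positivity
  nlinarith

theorem sinh_sq_le_cosh {k : ℕ} (hk : 2 ≤ k) (hx : 0 < x) :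
    Real.sinh x ^ 2 ≤ Real.cosh (k * x) := by
  have h := cosh_nat_mul_le hk hx
  rw [Nat.cast_ofNat, Real.cosh_two_mul] at h
  nlinarith [sq_nonneg (Real.cosh x)]

theorem cosh_sq_le_cosh {k : ℕ} (hk : 2 ≤ k) (hx : 0 < x) :
    Real.cosh x ^ 2 ≤ Real.cosh (k * x) := by
  have h := cosh_nat_mul_le hk hx
  rw [Nat.cast_ofNat, Real.cosh_two_mul] at h
  nlinarith [sq_nonneg (Real.sinh x)]

theorem sinh_sq_mul_cosh_le_cosh {k : ℕ} (hk : 3 ≤ k) (hx : 0 < x) :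
    2 * Real.sinh x ^ 2 * Real.cosh x ≤ Real.cosh (k * x) := by
  have h := cosh_nat_mul_le hk hx
  rw [Nat.cast_ofNat, Real.cosh_three_mul] at h
  have h1 := Real.sinh_sq x
  have h2 := Real.one_le_cosh x
  rw [h1]
  nlinarith [pow_le_pow_left₀ zero_le_one h2 2,
    mul_nonneg (sub_nonneg.mpr h2) (sq_nonneg (Real.cosh x)),
    mul_nonneg (by linarith : (0 : ℝ) ≤ Real.cosh x) (sq_nonneg (Real.cosh x - 1))]

end HyperbolicBounds

/-! ### Interpolation of `(π - θ) cos θ` at the zeros of `sin nθ` -/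

section SineKernel

theorem integrableOn_sinh_mul_cosh_div {n : ℕ} (hn : 2 ≤ n) {θ : ℝ}
    (hθ : θ ∈ Set.Ioo 0 (2 * Real.pi)) (hne : θ ≠ Real.pi) :
    IntegrableOn (fun x => Real.sinh x * Real.cosh x /
      (Real.sinh (n * x) * (Real.cosh x - Real.cos θ))) (Set.Ioi 0) := by
  refine integrableOn_Ioi_of_nonneg_of_le (integral_one_div_cosh_sub_cos hθ hne).1 (by fun_prop)
    (fun x hx => ?_) fun x hx => ?_
  · have := cosh_sub_cos_pos hx θ
    have := sinh_nat_mul_pos (k := n) (by omega) hx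
    have := Real.sinh_pos_iff.mpr hx
    positivity
  · have hD := cosh_sub_cos_pos hx θ
    have hS := sinh_nat_mul_pos (k := n) (by omega) hx
    rw [div_le_div_iff₀ (by positivity) hD, one_mul]
    exact mul_le_mul_of_nonneg_right (sinh_mul_cosh_le_sinh hn hx) hD.le

theorem integrableOn_sine_coefficient {j k : ℕ} (hk : 2 ≤ k) (hj : j < k) :
    IntegrableOn (fun x => Real.sinh x * Real.cosh x * (2 * Real.sinh ((j + 1) * x)) /
      (Real.sinh (k * x) * Real.sinh ((k + 1) * x))) (Set.Ioi 0) := by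
  refine integrableOn_Ioi_of_nonneg_of_le integrableOn_one_div_cosh (by fun_prop)
    (fun x hx => ?_) fun x hx => ?_
  · have h1 := Real.sinh_pos_iff.mpr hx
    have h2 := sinh_nat_mul_pos (k := k) (by omega) hx
    have h3 := sinh_nat_mul_pos (k := k + 1) (by omega) hx
    have h4 := sinh_nat_mul_pos (k := j + 1) (by omega) hx
    push_cast at h3 h4
    positivity
  · have h1 := Real.sinh_pos_iff.mpr hx
    have h2 := sinh_nat_mul_pos (k := k) (by omega) hx
    have h3 := sinh_nat_mul_pos (k := k + 1) (by omega) hx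
    have h4 := sinh_nat_mul_le (show j + 1 ≤ k from hj) hx
    have h5 := two_mul_sinh_mul_cosh_sq_le_sinh (show 3 ≤ k + 1 by omega) hx
    have hc := Real.cosh_pos x
    push_cast at h3 h4 h5
    rw [div_le_div_iff₀ (by positivity) hc, one_mul]
    calc Real.sinh x * Real.cosh x * (2 * Real.sinh ((j + 1) * x)) * Real.cosh x
        = Real.sinh ((j + 1) * x) * (2 * Real.sinh x * Real.cosh x ^ 2) := by ring
      _ ≤ Real.sinh (k * x) * Real.sinh ((k + 1) * x) := by gcongr

/-- Christoffel–Darboux divided by `sinh kx * sinh (k+1)x` cancels `cosh x - cos θ`, leaving a sine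
polynomial of degree `k` whose coefficients are integrals in `x`. -/
theorem sin_mul_integral_sub_eq {k : ℕ} (hk : 2 ≤ k) {θ : ℝ}
    (hθ : θ ∈ Set.Ioo 0 (2 * Real.pi)) (hne : θ ≠ Real.pi) :
    Real.sin (k * θ) * (∫ x in Set.Ioi 0, Real.sinh x * Real.cosh x /
        (Real.sinh (k * x) * (Real.cosh x - Real.cos θ))) -
      Real.sin ((k + 1 : ℕ) * θ) * (∫ x in Set.Ioi 0, Real.sinh x * Real.cosh x /
        (Real.sinh ((k + 1 : ℕ) * x) * (Real.cosh x - Real.cos θ))) =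
      ∑ j ∈ Finset.range k, (∫ x in Set.Ioi 0,
        Real.sinh x * Real.cosh x * (2 * Real.sinh ((j + 1) * x)) /
          (Real.sinh (k * x) * Real.sinh ((k + 1) * x))) * Real.sin ((j + 1 : ℕ) * θ) := by
  simp only [← integral_const_mul, ← integral_mul_const]
  rw [← integral_sub ((integrableOn_sinh_mul_cosh_div hk hθ hne).const_mul _)
    ((integrableOn_sinh_mul_cosh_div (show 2 ≤ k + 1 by omega) hθ hne).const_mul _),
    ← integral_finsetSum _ fun j hj =>
      (integrableOn_sine_coefficient hk (Finset.mem_range.mp hj)).mul_const _]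
  refine setIntegral_congr_fun measurableSet_Ioi fun x hx => ?_
  have hD := (cosh_sub_cos_pos hx θ).ne'
  have h2 := (sinh_nat_mul_pos (k := k) (by omega) hx).ne'
  have h3 := (sinh_nat_mul_pos (k := k + 1) (by omega) hx).ne'
  push_cast at h3 ⊢
  have h := sinh_mul_sin_sub_eq x θ k
  have hsum : ∑ j ∈ Finset.range k, Real.sinh x * Real.cosh x * (2 * Real.sinh ((j + 1) * x)) /
      (Real.sinh (k * x) * Real.sinh ((k + 1) * x)) * Real.sin ((j + 1) * θ) =
      Real.sinh x * Real.cosh x / (Real.sinh (k * x) * Real.sinh ((k + 1) * x)) *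
        ∑ j ∈ Finset.range k, 2 * Real.sinh ((j + 1) * x) * Real.sin ((j + 1) * θ) := by
    rw [Finset.mul_sum]
    exact Finset.sum_congr rfl fun j _ => by ring
  rw [hsum]
  generalize ∑ j ∈ Finset.range k, 2 * Real.sinh ((j + 1) * x) * Real.sin ((j + 1) * θ) = S at h ⊢
  generalize Real.sinh ((k + 1) * x) = S₁, Real.sinh (k * x) = S₀, Real.sin ((k + 1) * θ) = s₁,
    Real.sin (k * θ) = s₀ at h h2 h3 ⊢
  field_simp
  linear_combination Real.sinh x * h

/-- The error of the interpolating polynomial of `(π - θ) cos θ` as a superposition of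
functions `sin (n θ) / (cosh x - cos θ)`. -/
theorem exists_trigPolynomial_sawtooth_mul_cos (n : ℕ) (hn : 2 ≤ n) :
    ∃ t : ℝ → ℝ, (fun θ => (t θ : ℂ)) ∈ trigPolynomials (n - 1) ∧
      ∀ θ ∈ Set.Ioo 0 (2 * Real.pi), θ ≠ Real.pi →
        (Real.pi - θ) * Real.cos θ - t θ = Real.sin (n * θ) * ∫ x in Set.Ioi 0,
          Real.sinh x * Real.cosh x / (Real.sinh (n * x) * (Real.cosh x - Real.cos θ)) := by
  induction n, hn using Nat.le_induction with
  | base =>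
    -- For `n = 2` the zero polynomial works: `sinh 2x = 2 sinh x cosh x` reduces the weight to
    -- `1/2`, and `sin 2θ / 2 = sin θ cos θ`.
    refine ⟨fun _ => 0, by simpa using zero_mem_trigPolynomials _, fun θ hθ hne => ?_⟩
    rw [← (integral_one_div_cosh_sub_cos hθ hne).2, Nat.cast_ofNat, Real.sin_two_mul]
    have : ∫ x in Set.Ioi 0, Real.sinh x * Real.cosh x /
        (Real.sinh (2 * x) * (Real.cosh x - Real.cos θ)) =
        (1 / 2) * ∫ x in Set.Ioi 0, 1 / (Real.cosh x - Real.cos θ) := by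
      rw [← integral_const_mul]
      refine setIntegral_congr_fun measurableSet_Ioi fun x hx => ?_
      have hD := (cosh_sub_cos_pos hx θ).ne'
      have h1 := (Real.sinh_pos_iff.mpr hx).ne'
      have h2 := (Real.cosh_pos x).ne'
      rw [Real.sinh_two_mul]
      field_simp
    rw [this]
    ring
  | succ k hk ih =>
    obtain ⟨t, ht, h⟩ := ih
    refine ⟨fun θ => t θ + ∑ j ∈ Finset.range k, (∫ x in Set.Ioi 0,
        Real.sinh x * Real.cosh x * (2 * Real.sinh ((j + 1) * x)) /
          (Real.sinh (k * x) * Real.sinh ((k + 1) * x))) * Real.sin ((j + 1 : ℕ) * θ), ?_, ?_⟩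
    · simp only [Complex.ofReal_add, Complex.ofReal_sum]
      exact add_mem_trigPolynomials (trigPolynomials_mono (by omega) ht)
        (sum_mem_trigPolynomials _ fun j hj => sin_mem_trigPolynomials
          (by have := Finset.mem_range.mp hj; omega) _)
    · intro θ hθ hne
      simp only
      rw [← sin_mul_integral_sub_eq hk hθ hne]
      linear_combination h θ hθ hne

end SineKernel

/-! ### Interpolation of `(π - θ) sin θ` at the zeros of `cos nθ` -/

section CosineKernel

theorem integrableOn_sinh_sq_div {n : ℕ} (hn : 2 ≤ n) {θ : ℝ}
    (hθ : θ ∈ Set.Ioo 0 (2 * Real.pi)) (hne : θ ≠ Real.pi) :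
    IntegrableOn (fun x => Real.sinh x ^ 2 /
      (Real.cosh (n * x) * (Real.cosh x - Real.cos θ))) (Set.Ioi 0) := by
  refine integrableOn_Ioi_of_nonneg_of_le (integral_one_div_cosh_sub_cos hθ hne).1 (by fun_prop)
    (fun x hx => ?_) fun x hx => ?_
  · have := cosh_sub_cos_pos hx θ
    have := Real.cosh_pos (n * x)
    positivity
  · have hD := cosh_sub_cos_pos hx θ
    have hS := Real.cosh_pos (n * x)
    rw [div_le_div_iff₀ (by positivity) hD, one_mul]
    exact mul_le_mul_of_nonneg_right (sinh_sq_le_cosh hn hx) hD.le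

theorem integrableOn_cosine_coefficient {j k : ℕ} (hk : 2 ≤ k) (hj : j ≤ k) :
    IntegrableOn (fun x => Real.sinh x ^ 2 * (2 * Real.cosh (j * x)) /
      (Real.cosh (k * x) * Real.cosh ((k + 1) * x))) (Set.Ioi 0) := by
  refine integrableOn_Ioi_of_nonneg_of_le integrableOn_one_div_cosh (by fun_prop)
    (fun x hx => ?_) fun x hx => ?_
  · have h2 := Real.cosh_pos (k * x)
    have h3 := Real.cosh_pos ((k + 1) * x)
    have h4 := Real.cosh_pos (j * x)
    positivity
  · have h2 := Real.cosh_pos (k * x)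
    have h3 := Real.cosh_pos ((k + 1) * x)
    have h4 := cosh_nat_mul_le hj hx
    have h5 := sinh_sq_mul_cosh_le_cosh (show 3 ≤ k + 1 by omega) hx
    have hc := Real.cosh_pos x
    push_cast at h5
    rw [div_le_div_iff₀ (by positivity) hc, one_mul]
    calc Real.sinh x ^ 2 * (2 * Real.cosh (j * x)) * Real.cosh x
        = Real.cosh (j * x) * (2 * Real.sinh x ^ 2 * Real.cosh x) := by ring
      _ ≤ Real.cosh (k * x) * Real.cosh ((k + 1) * x) := by gcongr

/-- The cosine analogue of `sin_mul_integral_sub_eq`. The constant term is written as half the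
coefficient of index `0`, so that one integrability lemma covers all coefficients. -/
theorem cos_mul_integral_sub_eq {k : ℕ} (hk : 2 ≤ k) {θ : ℝ}
    (hθ : θ ∈ Set.Ioo 0 (2 * Real.pi)) (hne : θ ≠ Real.pi) :
    Real.cos (k * θ) * (∫ x in Set.Ioi 0, Real.sinh x ^ 2 /
        (Real.cosh (k * x) * (Real.cosh x - Real.cos θ))) -
      Real.cos ((k + 1 : ℕ) * θ) * (∫ x in Set.Ioi 0, Real.sinh x ^ 2 /
        (Real.cosh ((k + 1 : ℕ) * x) * (Real.cosh x - Real.cos θ))) =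
      (∫ x in Set.Ioi 0, Real.sinh x ^ 2 * (2 * Real.cosh ((0 : ℕ) * x)) /
          (Real.cosh (k * x) * Real.cosh ((k + 1) * x))) * (1 / 2) +
      ∑ j ∈ Finset.range k, (∫ x in Set.Ioi 0,
        Real.sinh x ^ 2 * (2 * Real.cosh ((j + 1 : ℕ) * x)) /
          (Real.cosh (k * x) * Real.cosh ((k + 1) * x))) * Real.cos ((j + 1 : ℕ) * θ) := by
  have hi : ∀ j ∈ Finset.range k, IntegrableOn (fun x =>
      Real.sinh x ^ 2 * (2 * Real.cosh ((j + 1 : ℕ) * x)) /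
        (Real.cosh (k * x) * Real.cosh ((k + 1) * x)) * Real.cos ((j + 1 : ℕ) * θ)) (Set.Ioi 0) :=
    fun j hj => (integrableOn_cosine_coefficient (j := j + 1) hk
      (Finset.mem_range.mp hj)).mul_const _
  simp only [← integral_const_mul, ← integral_mul_const]
  rw [← integral_sub ((integrableOn_sinh_sq_div hk hθ hne).const_mul _)
    ((integrableOn_sinh_sq_div (show 2 ≤ k + 1 by omega) hθ hne).const_mul _),
    ← integral_finsetSum _ hi, ← integral_add
      ((integrableOn_cosine_coefficient (j := 0) hk (Nat.zero_le k)).mul_const _)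
      (integrable_finsetSum _ hi)]
  refine setIntegral_congr_fun measurableSet_Ioi fun x hx => ?_
  have hD := (cosh_sub_cos_pos hx θ).ne'
  have h2 := (Real.cosh_pos (k * x)).ne'
  have h3 := (Real.cosh_pos ((k + 1) * x)).ne'
  push_cast
  have h := cosh_mul_cos_sub_eq x θ k
  have hsum : ∑ j ∈ Finset.range k, Real.sinh x ^ 2 * (2 * Real.cosh ((j + 1) * x)) /
      (Real.cosh (k * x) * Real.cosh ((k + 1) * x)) * Real.cos ((j + 1) * θ) =
      Real.sinh x ^ 2 / (Real.cosh (k * x) * Real.cosh ((k + 1) * x)) *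
        ∑ j ∈ Finset.range k, 2 * Real.cosh ((j + 1) * x) * Real.cos ((j + 1) * θ) := by
    rw [Finset.mul_sum]
    exact Finset.sum_congr rfl fun j _ => by ring
  rw [hsum, zero_mul, Real.cosh_zero]
  generalize ∑ j ∈ Finset.range k, 2 * Real.cosh ((j + 1) * x) * Real.cos ((j + 1) * θ) = S at h ⊢
  generalize Real.cosh ((k + 1) * x) = C₁, Real.cosh (k * x) = C₀, Real.cos ((k + 1) * θ) = c₁,
    Real.cos (k * θ) = c₀ at h h2 h3 ⊢
  field_simp
  linear_combination Real.sinh x ^ 2 * h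

theorem integrableOn_cosh_div_cosh_two_mul :
    IntegrableOn (fun x => Real.cosh x / Real.cosh (2 * x)) (Set.Ioi 0) := by
  refine integrableOn_Ioi_of_nonneg_of_le integrableOn_one_div_cosh (by fun_prop)
    (fun x _ => (div_pos (Real.cosh_pos _) (Real.cosh_pos _)).le) fun x hx => ?_
  rw [div_le_div_iff₀ (Real.cosh_pos _) (Real.cosh_pos _), one_mul, ← sq]
  simpa using cosh_sq_le_cosh le_rfl hx

theorem integrableOn_one_div_cosh_two_mul :
    IntegrableOn (fun x => 1 / Real.cosh (2 * x)) (Set.Ioi 0) := by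
  refine integrableOn_Ioi_of_nonneg_of_le integrableOn_one_div_cosh (by fun_prop)
    (fun x _ => (one_div_pos.mpr (Real.cosh_pos _)).le) fun x hx => ?_
  have := cosh_nat_mul_le (show 1 ≤ 2 by omega) hx
  simp only [Nat.cast_one, Nat.cast_ofNat, one_mul] at this
  exact one_div_le_one_div_of_le (Real.cosh_pos _) this

/-- The base case `n = 2` of the induction. Under the integral it is the identity `sin² θ cosh 2x +
cos 2θ sinh² x = cosh² x - cos² θ`, whose right side is divisible by `cosh x - cos θ`. -/
theorem sawtooth_mul_sin_eq {θ : ℝ} (hθ : θ ∈ Set.Ioo 0 (2 * Real.pi)) (hne : θ ≠ Real.pi) :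
    (Real.pi - θ) * Real.sin θ = (∫ x in Set.Ioi 0, Real.cosh x / Real.cosh (2 * x)) +
      (∫ x in Set.Ioi 0, 1 / Real.cosh (2 * x)) * Real.cos θ -
      Real.cos (2 * θ) * ∫ x in Set.Ioi 0, Real.sinh x ^ 2 /
        (Real.cosh (2 * x) * (Real.cosh x - Real.cos θ)) := by
  obtain ⟨hI, hv⟩ := integral_one_div_cosh_sub_cos hθ hne
  have hA := integrableOn_sinh_sq_div le_rfl hθ hne
  rw [Nat.cast_ofNat] at hA
  have hB := integrableOn_one_div_cosh_two_mul.mul_const (Real.cos θ)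
  have hsum := integral_add integrableOn_cosh_div_cosh_two_mul hB
  have hsub := integral_sub (integrableOn_cosh_div_cosh_two_mul.add hB)
    (hA.const_mul (Real.cos (2 * θ)))
  simp only [Pi.add_apply] at hsub hsum
  rw [← hv, mul_right_comm, ← integral_const_mul, ← integral_const_mul, ← integral_mul_const,
    ← hsum, ← hsub]
  refine setIntegral_congr_fun measurableSet_Ioi fun x hx => ?_
  have hD := (cosh_sub_cos_pos hx θ).ne'
  have h2 := (Real.cosh_pos (2 * x)).ne'
  field_simp
  rw [Real.cos_two_mul, Real.cosh_two_mul, Real.sinh_sq, Real.sin_sq]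
  ring

theorem exists_trigPolynomial_sawtooth_mul_sin (n : ℕ) (hn : 2 ≤ n) :
    ∃ t : ℝ → ℝ, (fun θ => (t θ : ℂ)) ∈ trigPolynomials (n - 1) ∧
      ∀ θ ∈ Set.Ioo 0 (2 * Real.pi), θ ≠ Real.pi →
        (Real.pi - θ) * Real.sin θ - t θ = -Real.cos (n * θ) * ∫ x in Set.Ioi 0,
          Real.sinh x ^ 2 / (Real.cosh (n * x) * (Real.cosh x - Real.cos θ)) := by
  have hconst : ∀ (m : ℕ) (a : ℝ), (fun _ : ℝ => (a : ℂ)) ∈ trigPolynomials m := fun m a => by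
    simpa using cos_mem_trigPolynomials (Nat.zero_le m) a
  induction n, hn using Nat.le_induction with
  | base =>
    refine ⟨fun θ => (∫ x in Set.Ioi 0, Real.cosh x / Real.cosh (2 * x)) +
      (∫ x in Set.Ioi 0, 1 / Real.cosh (2 * x)) * Real.cos ((1 : ℕ) * θ), ?_, fun θ hθ hne => ?_⟩
    · simp only [Complex.ofReal_add]
      exact add_mem_trigPolynomials (hconst _ _) (cos_mem_trigPolynomials le_rfl _)
    · simp only [Nat.cast_one, one_mul, Nat.cast_ofNat]
      rw [sawtooth_mul_sin_eq hθ hne]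
      ring
  | succ k hk ih =>
    obtain ⟨t, ht, h⟩ := ih
    refine ⟨fun θ => t θ - ((∫ x in Set.Ioi 0, Real.sinh x ^ 2 * (2 * Real.cosh ((0 : ℕ) * x)) /
          (Real.cosh (k * x) * Real.cosh ((k + 1) * x))) * (1 / 2) +
      ∑ j ∈ Finset.range k, (∫ x in Set.Ioi 0,
        Real.sinh x ^ 2 * (2 * Real.cosh ((j + 1 : ℕ) * x)) /
          (Real.cosh (k * x) * Real.cosh ((k + 1) * x))) * Real.cos ((j + 1 : ℕ) * θ)), ?_, ?_⟩
    · simp only [sub_eq_add_neg, neg_add, ← Finset.sum_neg_distrib, ← neg_mul, Complex.ofReal_add,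
        Complex.ofReal_sum]
      exact add_mem_trigPolynomials (trigPolynomials_mono (by omega) ht) (add_mem_trigPolynomials
        (hconst _ _) (sum_mem_trigPolynomials _ fun j hj => cos_mem_trigPolynomials
          (by have := Finset.mem_range.mp hj; omega) _))
    · intro θ hθ hne
      simp only
      rw [← cos_mul_integral_sub_eq hk hθ hne]
      linear_combination h θ hθ hne

end CosineKernel

/-! ### Evaluation of the dual integrals -/

section Moments

variable {n : ℕ} {σ : ℝ → ℝ}

/-- The moment formula for frequency `1` and multiplier `-exp (iπ/n)`, which differs from `1`
because `n ≥ 2`. The real and imaginary parts serve the two kernels. -/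
theorem integral_sawtooth_mul_exp_mul_sign (hn : 2 ≤ n) (hσ : Continuous σ)
    (hanti : Function.Antiperiodic σ (Real.pi / n)) :
    ∫ θ in (0 : ℝ)..(2 * Real.pi),
        ((Real.pi - θ : ℝ) : ℂ) * (Complex.exp (Complex.I * θ) * (Real.sign (σ θ) : ℂ)) =
      2 * Real.pi / (1 + Complex.exp (Complex.I * (Real.pi / n))) *
        ∫ θ in (0 : ℝ)..(Real.pi / n), Complex.exp (Complex.I * θ) * (Real.sign (σ θ) : ℂ) := by
  have hint : ∀ a b, IntervalIntegrable
      (fun θ : ℝ => Complex.exp (Complex.I * (1 : ℤ) * θ) * (Real.sign (σ θ) : ℂ)) volume a b :=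
    fun a b => intervalIntegrable_mul_sign (Continuous.intervalIntegrable (by fun_prop) _ _) hσ
  have h := intervalIntegral_moment_eq hint (periodic_exp_mul_sign (by omega) hanti 1)
    (exp_mul_sign_add hanti 1) (neg_exp_ne_one (by rw [abs_one]; exact_mod_cast hn)) Real.pi
  simp only [Int.cast_one, mul_one, one_mul, sub_neg_eq_add] at h
  rw [h, mul_comm Complex.I]
  push_cast
  rfl

theorem integral_sawtooth_mul_cos_mul_sign (hσ : Continuous σ) :
    ∫ θ in (0 : ℝ)..(2 * Real.pi), (Real.pi - θ) * Real.cos θ * Real.sign (σ θ) =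
      (∫ θ in (0 : ℝ)..(2 * Real.pi), ((Real.pi - θ : ℝ) : ℂ) *
        (Complex.exp (Complex.I * θ) * (Real.sign (σ θ) : ℂ))).re := by
  simp only [← mul_assoc]
  have hint := intervalIntegrable_mul_sign (u := fun θ : ℝ => ((Real.pi - θ : ℝ) : ℂ) *
    Complex.exp (Complex.I * θ)) (Continuous.intervalIntegrable (by fun_prop) 0 (2 * Real.pi)) hσ
  refine Eq.trans ?_ (Complex.reCLM.intervalIntegral_comp_comm hint)
  refine intervalIntegral.integral_congr fun θ _ => ?_
  simp only [Complex.reCLM_apply, Complex.re_mul_ofReal, Complex.re_ofReal_mul]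
  rw [mul_comm Complex.I, Complex.exp_ofReal_mul_I_re]

theorem integral_sawtooth_mul_sin_mul_sign (hσ : Continuous σ) :
    ∫ θ in (0 : ℝ)..(2 * Real.pi), (Real.pi - θ) * Real.sin θ * Real.sign (σ θ) =
      (∫ θ in (0 : ℝ)..(2 * Real.pi), ((Real.pi - θ : ℝ) : ℂ) *
        (Complex.exp (Complex.I * θ) * (Real.sign (σ θ) : ℂ))).im := by
  simp only [← mul_assoc]
  have hint := intervalIntegrable_mul_sign (u := fun θ : ℝ => ((Real.pi - θ : ℝ) : ℂ) *
    Complex.exp (Complex.I * θ)) (Continuous.intervalIntegrable (by fun_prop) 0 (2 * Real.pi)) hσ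
  refine Eq.trans ?_ (Complex.imCLM.intervalIntegral_comp_comm hint)
  refine intervalIntegral.integral_congr fun θ _ => ?_
  simp only [Complex.imCLM_apply, Complex.im_mul_ofReal, Complex.im_ofReal_mul]
  rw [mul_comm Complex.I, Complex.exp_ofReal_mul_I_im]

theorem integral_exp_I_mul (a b : ℝ) : ∫ θ in a..b, Complex.exp (Complex.I * θ) =
    (Complex.exp (Complex.I * b) - Complex.exp (Complex.I * a)) / Complex.I :=
  integral_exp_mul_complex Complex.I_ne_zero

theorem one_add_exp_I_eq (b : ℝ) : 1 + Complex.exp (Complex.I * b) ^ 2 =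
    2 * Real.cos b * Complex.exp (Complex.I * b) := by
  have h : Complex.exp (Complex.I * b) * Complex.exp (-(Complex.I * b)) = 1 := by
    rw [← Complex.exp_add, add_neg_cancel, Complex.exp_zero]
  rw [Complex.ofReal_cos, Complex.cos, mul_comm (b : ℂ), neg_mul, mul_comm (b : ℂ)]
  linear_combination -h

theorem antiperiodic_sin_nat_mul (hn : n ≠ 0) :
    Function.Antiperiodic (fun θ : ℝ => Real.sin (n * θ)) (Real.pi / n) := fun θ => by
  have hn' : (n : ℝ) ≠ 0 := by exact_mod_cast hn
  simp only
  rw [mul_add, mul_div_cancel₀ _ hn', Real.sin_add_pi]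

theorem antiperiodic_neg_cos_nat_mul (hn : n ≠ 0) :
    Function.Antiperiodic (fun θ : ℝ => -Real.cos (n * θ)) (Real.pi / n) := fun θ => by
  have hn' : (n : ℝ) ≠ 0 := by exact_mod_cast hn
  simp only
  rw [mul_add, mul_div_cancel₀ _ hn', Real.cos_add_pi]

theorem cos_pi_div_two_mul_pos (hn : 2 ≤ n) : 0 < Real.cos (Real.pi / (2 * n)) := by
  have hn' : (2 : ℝ) ≤ n := by exact_mod_cast hn
  have hpi := Real.pi_pos
  refine Real.cos_pos_of_mem_Ioo ⟨by have : 0 < Real.pi / (2 * n) := by positivity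
                                     linarith, ?_⟩
  exact div_lt_div_of_pos_left hpi two_pos (by linarith)

/-- The sign is `1` on `(0, π/n)`. With `b = π/(2n)`, the integral `2 sin b exp (ib)` is divided by
`1 + exp (2ib) = 2 cos b exp (ib)`, and the phases cancel. -/
theorem integral_sawtooth_mul_cos_mul_sign_sin (hn : 2 ≤ n) :
    ∫ θ in (0 : ℝ)..(2 * Real.pi), (Real.pi - θ) * Real.cos θ * Real.sign (Real.sin (n * θ)) =
      2 * Real.pi * Real.tan (Real.pi / (2 * n)) := by
  have hσ : Continuous fun θ : ℝ => Real.sin (n * θ) := by fun_prop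
  have hn0 : (0 : ℝ) < n := by exact_mod_cast (by omega : 0 < n)
  rw [integral_sawtooth_mul_cos_mul_sign hσ,
    integral_sawtooth_mul_exp_mul_sign hn hσ (antiperiodic_sin_nat_mul (by omega))]
  have h1 : ∫ θ in (0 : ℝ)..(Real.pi / n),
      Complex.exp (Complex.I * θ) * (Real.sign (Real.sin (n * θ)) : ℂ) =
      ∫ θ in (0 : ℝ)..(Real.pi / n), Complex.exp (Complex.I * θ) := by
    refine intervalIntegral.integral_congr_ae ?_
    filter_upwards [ae_mem_Ioo_of_mem_uIoc 0 (Real.pi / n) (div_pos Real.pi_pos hn0).le]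
      with θ hθ h
    obtain ⟨ha, hb⟩ := hθ h
    rw [lt_div_iff₀ hn0, mul_comm] at hb
    rw [Real.sign_of_pos (Real.sin_pos_of_pos_of_lt_pi (by positivity) hb), Complex.ofReal_one,
      mul_one]
  rw [h1, integral_exp_I_mul]
  have hc := cos_pi_div_two_mul_pos hn
  have hone := one_add_exp_I_eq (Real.pi / (2 * n))
  rw [Real.tan_eq_sin_div_cos]
  set b := Real.pi / (2 * n) with hb
  have hb2 : Real.pi / n = 2 * b := by rw [hb]; field_simp
  have hbc : Complex.exp (Complex.I * (Real.pi / n)) = Complex.exp (Complex.I * b) ^ 2 := by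
    rw [← Complex.exp_nat_mul]
    congr 1
    have := congrArg Complex.ofReal hb2
    push_cast at this ⊢
    rw [this]
    ring
  have hsub : Complex.exp (Complex.I * b) ^ 2 - 1 =
      2 * Real.sin b * Complex.I * Complex.exp (Complex.I * b) := by
    have h : Complex.exp (Complex.I * b) * Complex.exp (-(Complex.I * b)) = 1 := by
      rw [← Complex.exp_add, add_neg_cancel, Complex.exp_zero]
    rw [Complex.ofReal_sin, Complex.sin, mul_comm (b : ℂ), neg_mul, mul_comm (b : ℂ)]
    linear_combination h - (Complex.exp (Complex.I * b) * Complex.exp (-(Complex.I * b)) -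
      Complex.exp (Complex.I * b) ^ 2) * Complex.I_sq
  push_cast
  rw [hbc, hone, mul_zero, Complex.exp_zero, hsub]
  have he := Complex.exp_ne_zero (Complex.I * b)
  have hcc : (Real.cos b : ℂ) ≠ 0 := by exact_mod_cast hc.ne'
  have : 2 * (Real.pi : ℂ) / (2 * Real.cos b * Complex.exp (Complex.I * b)) *
      (2 * Real.sin b * Complex.I * Complex.exp (Complex.I * b) / Complex.I) =
      ((2 * Real.pi * (Real.sin b / Real.cos b) : ℝ) : ℂ) := by
    have := Complex.I_ne_zero
    push_cast [-Complex.ofReal_sin, -Complex.ofReal_cos]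
    field_simp
  rw [this, Complex.ofReal_re]

/-- With `b = π/(2n)`, the sign is `-1` on `(0, b)` and `1` on `(b, 2b)`. The integral is `(exp (ib)
- 1)² / i`, and division by `2 cos b exp (ib)` gives the purely imaginary value `i (1 / cos b - 1)`.
-/
theorem integral_sawtooth_mul_sin_mul_sign_neg_cos (hn : 2 ≤ n) :
    ∫ θ in (0 : ℝ)..(2 * Real.pi), (Real.pi - θ) * Real.sin θ * Real.sign (-Real.cos (n * θ)) =
      2 * Real.pi * (1 / Real.cos (Real.pi / (2 * n)) - 1) := by
  have hσ : Continuous fun θ : ℝ => -Real.cos (n * θ) := by fun_prop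
  have hn0 : (0 : ℝ) < n := by exact_mod_cast (by omega : 0 < n)
  have hpi := Real.pi_pos
  rw [integral_sawtooth_mul_sin_mul_sign hσ,
    integral_sawtooth_mul_exp_mul_sign hn hσ (antiperiodic_neg_cos_nat_mul (by omega))]
  have hc := cos_pi_div_two_mul_pos hn
  have hone := one_add_exp_I_eq (Real.pi / (2 * n))
  set b := Real.pi / (2 * n) with hb
  have hb0 : 0 < b := by positivity
  have hb2 : Real.pi / n = 2 * b := by rw [hb]; field_simp
  have hnb : n * b = Real.pi / 2 := by rw [hb]; field_simp
  have h1 : ∫ θ in (0 : ℝ)..b,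
      Complex.exp (Complex.I * θ) * (Real.sign (-Real.cos (n * θ)) : ℂ) =
      -∫ θ in (0 : ℝ)..b, Complex.exp (Complex.I * θ) := by
    rw [← intervalIntegral.integral_neg]
    refine intervalIntegral.integral_congr_ae ?_
    filter_upwards [ae_mem_Ioo_of_mem_uIoc 0 b hb0.le] with θ hθ h
    obtain ⟨ha, hb⟩ := hθ h
    have h2 : n * θ < Real.pi / 2 := hnb ▸ mul_lt_mul_of_pos_left hb hn0
    have h3 : 0 < n * θ := by positivity
    rw [Real.sign_of_neg (neg_neg_of_pos (Real.cos_pos_of_mem_Ioo ⟨by linarith, h2⟩))]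
    push_cast
    ring
  have h2 : ∫ θ in b..(2 * b),
      Complex.exp (Complex.I * θ) * (Real.sign (-Real.cos (n * θ)) : ℂ) =
      ∫ θ in b..(2 * b), Complex.exp (Complex.I * θ) := by
    refine intervalIntegral.integral_congr_ae ?_
    filter_upwards [ae_mem_Ioo_of_mem_uIoc b (2 * b) (by linarith)] with θ hθ h
    obtain ⟨ha, hb⟩ := hθ h
    have h2 : Real.pi / 2 < n * θ := hnb ▸ mul_lt_mul_of_pos_left ha hn0
    have h3 : n * θ < Real.pi := by
      have := mul_lt_mul_of_pos_left hb hn0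
      linarith
    rw [Real.sign_of_pos
      (neg_pos_of_neg (Real.cos_neg_of_pi_div_two_lt_of_lt h2 (by linarith)))]
    push_cast
    ring
  have hint : ∀ a c, IntervalIntegrable
      (fun θ : ℝ => Complex.exp (Complex.I * θ) * (Real.sign (-Real.cos (n * θ)) : ℂ))
      volume a c :=
    fun a c => intervalIntegrable_mul_sign (Continuous.intervalIntegrable (by fun_prop) _ _) hσ
  have hsq : Complex.exp (Complex.I * (2 * b)) = Complex.exp (Complex.I * b) ^ 2 := by
    rw [← Complex.exp_nat_mul]
    congr 1
    push_cast
    ring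
  have hbc : Complex.I * ((Real.pi : ℂ) / n) = Complex.I * (2 * b) := by
    have := congrArg Complex.ofReal hb2
    push_cast at this
    rw [this]
  rw [hbc, hb2, ← intervalIntegral.integral_add_adjacent_intervals (hint 0 b) (hint b (2 * b)),
    h1, h2, integral_exp_I_mul, integral_exp_I_mul]
  push_cast
  rw [mul_zero, Complex.exp_zero, hsq, hone]
  have he := Complex.exp_ne_zero (Complex.I * b)
  have hcc : (Real.cos b : ℂ) ≠ 0 := by exact_mod_cast hc.ne'
  have : 2 * (Real.pi : ℂ) / (2 * Real.cos b * Complex.exp (Complex.I * b)) *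
      (-((Complex.exp (Complex.I * b) - 1) / Complex.I) +
        (Complex.exp (Complex.I * b) ^ 2 - Complex.exp (Complex.I * b)) / Complex.I) =
      ((2 * Real.pi * (1 / Real.cos b - 1) : ℝ) : ℂ) * Complex.I := by
    have hI := Complex.I_ne_zero
    push_cast [-Complex.ofReal_sin, -Complex.ofReal_cos]
    field_simp
    rw [Complex.I_sq]
    linear_combination hone
  rw [this, Complex.im_ofReal_mul, Complex.I_im, mul_one]

end Moments

/-! ### The best approximation errors -/

theorem theorem1 (n : ℕ) (hn : 2 ≤ n) :
    (IntervalIntegrable quasiBernoulliCos MeasureTheory.volume 0 (2 * Real.pi) ∧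
      bestL1Approx (n - 1) quasiBernoulliCos = Real.tan (Real.pi / (2 * (n : ℝ)))) ∧
    (IntervalIntegrable quasiBernoulliSin MeasureTheory.volume 0 (2 * Real.pi) ∧
      bestL1Approx (n - 1) quasiBernoulliSin = 1 / Real.cos (Real.pi / (2 * (n : ℝ))) - 1) := by
  have hpi := Real.pi_pos
  have hn0 : n ≠ 0 := by omega
  have hcos : ∀ θ ∈ Set.Ioo 0 (2 * Real.pi),
      quasiBernoulliCos θ = (((Real.pi - θ) * Real.cos θ : ℝ) : ℂ) := fun θ hθ => by
    rw [quasiBernoulliCos, bernoulliKernel_one_eq hθ, Complex.ofReal_mul]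
  have hsin : ∀ θ ∈ Set.Ioo 0 (2 * Real.pi),
      quasiBernoulliSin θ = (((Real.pi - θ) * Real.sin θ : ℝ) : ℂ) := fun θ hθ => by
    rw [quasiBernoulliSin, bernoulliKernel_one_eq hθ, Complex.ofReal_mul]
  refine ⟨⟨intervalIntegrable_of_eqOn_Ioo (by fun_prop) (by positivity) hcos, ?_⟩,
    intervalIntegrable_of_eqOn_Ioo (by fun_prop) (by positivity) hsin, ?_⟩
  · obtain ⟨t, ht, h⟩ := exists_trigPolynomial_sawtooth_mul_cos n hn
    rw [bestL1Approx_eq_integral_mul_sign hn0 (by fun_prop) hcos (by fun_prop)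
      (antiperiodic_sin_nat_mul hn0) ht fun θ hθ hne => ⟨?_, h θ hθ hne⟩,
      integral_sawtooth_mul_cos_mul_sign_sin hn]
    · field_simp
    · refine setIntegral_nonneg measurableSet_Ioi fun x hx => ?_
      have h1 := cosh_sub_cos_pos hx θ
      have h2 := sinh_nat_mul_pos (Nat.pos_of_ne_zero hn0) hx
      have h3 := Real.sinh_pos_iff.mpr hx
      positivity
  · obtain ⟨t, ht, h⟩ := exists_trigPolynomial_sawtooth_mul_sin n hn
    rw [bestL1Approx_eq_integral_mul_sign hn0 (by fun_prop) hsin (by fun_prop)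
      (antiperiodic_neg_cos_nat_mul hn0) ht fun θ hθ hne => ⟨?_, h θ hθ hne⟩,
      integral_sawtooth_mul_sin_mul_sign_neg_cos hn]
    · field_simp
    · refine setIntegral_nonneg measurableSet_Ioi fun x hx => ?_
      have h1 := cosh_sub_cos_pos hx θ
      have h2 := Real.cosh_pos (n * x)
      positivity
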